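/- For each horizon $T\in\mathbb N$ consider a bandit with $K=K(T)\ge 1$ arms and reward distributions $\mathcal P_a=\mathcal P_{a}^{(T)}$, $a\in[K]$, on $\mathbb R$ with means $\mu_a$; let $\Delta_a=\max_b\mu_b-\mu_a$. All of these may depend on $T$. The UCB algorithm with known horizon $T$ pulls each arm once in the first $K$ rounds, and for $t=K,\dots,T-1$ it pulls in round $t+1$ an arm $A_{t+1}$ that maximizes $$\mathrm{UCB}(a,t)=\bar X_{a,t}+\sqrt{\frac{2\log T}{n_{a,t}}},$$ where $n_{a,t}$ and $\bar X_{a,t}$ are the number of pulls of arm $a$ and the sample mean of its rewards in rounds $1,\dots,t$ (ties are broken arbitrarily, without looking at future rewards). Given the past and $A_t$, the reward $X_t$ has distribution $\mathcal P_{A_t}$. Assume that each $\mathcal P_a$ is $\lambda_a$-sub-Gaussian, i.e. $\mathbb E_{X\sim\mathcal P_a}e^{s(X-\mu_a)}\le e^{\lambda_a^2s^2/2}$ for all $s\in\mathbb R$, where $0\le\lambda_a\le L$ for all arms and all $T$ with a constant $L<\infty$, and that $\log K/\log T\to 0$ as $T\to\infty$. Then for every $T\ge 2$ there is a unique $n^\star=n^\star(T)>0$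 such that $$\sum_{a\in[K]}\frac{1}{\left(\sqrt{T/n^\star}+\sqrt{T\Delta_a^2/(2\log T)}\right)^2}=1 .$$ Assume moreover that there are $B>0$, $\alpha>0$ and $T_0$ such that for all $T\ge T_0$ $$\frac1K\,\left|\left\{a\in[K]:\sqrt{\frac{n^\star\Delta_a^2}{2\log T}}\le B\right\}\right|\ \ge\ \alpha .$$ Then: (i) for every choice of arms $a=a(T)\in[K(T)]$ with $\Delta_a/\sqrt{2\log T}\to0$, $$\frac{n_{a,T}}{\left(1/\sqrt{n^\star}+\Delta_a/\sqrt{2\log T}\right)^{-2}}\longrightarrow 1\quad\text{in probability as } T\to\infty;$$ (ii) if $\max_{a\in[K]}\Delta_a/\sqrt{2\log T}\to0$, then this convergence is uniform over all arms: $$\max_{a\in[K]}\left|\frac{n_{a,T}}{\left(1/\sqrt{n^\star}+\Delta_a/\sqrt{2\log T}\right)^{-2}}-1\right|\longrightarrow 0\quad\text{in probability as } T\to\infty.$$ -/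

import Mathlib

open MeasureTheory ProbabilityTheory Filter Topology
open scoped NNReal ENNReal

namespace UCB

noncomputable section

/-- Number of pulls `n_{a,t}` of arm `a` in rounds `1, …, t`;
`A s ω` is the arm pulled in round `s`. -/
def pulls {Ω : Type*} {K : ℕ} (A : ℕ → Ω → Fin K) (a : Fin K) (t : ℕ) (ω : Ω) : ℕ :=
  ((Finset.Icc 1 t).filter (fun s => A s ω = a)).card

/-- Sample mean of the rewards of arm `a` in rounds `1, …, t`;
`X s ω` is the reward received in round `s`. -/
def sampleMean {Ω : Type*} {K : ℕ} (A : ℕ → Ω → Fin K) (X : ℕ → Ω → ℝ)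
    (a : Fin K) (t : ℕ) (ω : Ω) : ℝ :=
  (∑ s ∈ (Finset.Icc 1 t).filter (fun s => A s ω = a), X s ω) / (pulls A a t ω : ℝ)

/-- The upper confidence bound of arm `a` after `t` rounds, for the horizon `T`. -/
def ucb {Ω : Type*} {K : ℕ} (T : ℕ) (A : ℕ → Ω → Fin K) (X : ℕ → Ω → ℝ)
    (a : Fin K) (t : ℕ) (ω : Ω) : ℝ :=
  sampleMean A X a t ω + √(2 * Real.log (T : ℝ) / (pulls A a t ω : ℝ))

/-- The arms `A 1, …, A T` and the rewards `X 1, …, X T` form a run of the UCB algorithm with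
horizon `T` on the bandit with reward distributions `ν`. The σ-algebra `ℱ t` is the information
available after `t` rounds; it may contain extra randomness, and ties may be broken in any way. -/
structure IsUCBRun {Ω : Type*} [m : MeasurableSpace Ω] (P : Measure Ω) {K : ℕ} (T : ℕ)
    (ν : Fin K → Measure ℝ) (ℱ : Filtration ℕ m)
    (A : ℕ → Ω → Fin K) (X : ℕ → Ω → ℝ) : Prop where
  /-- The arm of the next round is chosen from the information available. -/
  arm_measurable : ∀ t, t < T → Measurable[ℱ t] (A (t + 1))
  /-- The reward of the next round is known after that round. -/
  reward_measurable : ∀ t, t < T → Measurable[ℱ (t + 1)] (X (t + 1))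
  /-- Given the past, the reward of the next round has the distribution of the chosen arm. -/
  reward_law : ∀ t, t < T → ∀ (a : Fin K) (D : Set Ω), MeasurableSet[ℱ t] D →
    ∀ S : Set ℝ, MeasurableSet S →
      P (D ∩ {ω | A (t + 1) ω = a} ∩ {ω | X (t + 1) ω ∈ S})
        = P (D ∩ {ω | A (t + 1) ω = a}) * ν a S
  /-- Each arm is pulled exactly once in the first `K` rounds. -/
  init : ∀ᵐ ω ∂P, ∀ a : Fin K, pulls A a K ω = 1
  /-- Afterwards an arm with the largest upper confidence bound is pulled. -/
  argmax : ∀ᵐ ω ∂P, ∀ t, K ≤ t → t < T →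
    ∀ a : Fin K, ucb T A X a t ω ≤ ucb T A X (A (t + 1) ω) t ω

/-- The mean reward of arm `a`. -/
def armMean {K : ℕ} (ν : Fin K → Measure ℝ) (a : Fin K) : ℝ := ∫ x, x ∂(ν a)

/-- The gap `Δ_a` between the largest mean reward and that of arm `a`. -/
def gap {K : ℕ} (ν : Fin K → Measure ℝ) (a : Fin K) : ℝ :=
  (⨆ b : Fin K, armMean ν b) - armMean ν a

/-- A distribution on the line is `lam`-sub-Gaussian:
`𝔼 exp (s (X - 𝔼 X)) ≤ exp (lam ^ 2 * s ^ 2 / 2)` for all real `s`. -/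
def IsSubGaussian (lam : ℝ≥0) (ρ : Measure ℝ) : Prop :=
  HasSubgaussianMGF (fun x : ℝ => x - ∫ y, y ∂ρ) (lam ^ 2) ρ

/-- `n` is a (positive) solution of the equation that characterizes `n⋆`, for the horizon `T` and
the gaps `Δ`. -/
def IsNStar {K : ℕ} (T : ℕ) (Δ : Fin K → ℝ) (n : ℝ) : Prop :=
  0 < n ∧ ∑ a : Fin K,
    1 / (√((T : ℝ) / n) + √((T : ℝ) * Δ a ^ 2 / (2 * Real.log (T : ℝ)))) ^ 2 = 1

/-- The `B`-near-optimal arms. -/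
def nearOptimal {K : ℕ} (T : ℕ) (Δ : Fin K → ℝ) (n B : ℝ) : Set (Fin K) :=
  {a | √(n * Δ a ^ 2 / (2 * Real.log (T : ℝ))) ≤ B}

/-- The number of pulls of arm `a` in `T` rounds, divided by
`(1 / √n + Δ_a / √(2 log T))⁻²`. -/
def pullRatio {Ω : Type*} {K : ℕ} (T : ℕ) (Δ : Fin K → ℝ) (n : ℝ)
    (A : ℕ → Ω → Fin K) (a : Fin K) (ω : Ω) : ℝ :=
  (pulls A a T ω : ℝ) / (1 / √n + Δ a / √(2 * Real.log (T : ℝ))) ^ (-2 : ℤ)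

/-- Convergence in probability to a constant, the probability space may change with `T`. -/
def TendstoInProb {Ω : ℕ → Type*} [∀ T, MeasurableSpace (Ω T)] (P : ∀ T, Measure (Ω T))
    (Y : ∀ T, Ω T → ℝ) (c : ℝ) : Prop :=
  ∀ ε : ℝ, 0 < ε → Tendsto (fun T => P T {ω | ε ≤ |Y T ω - c|}) atTop (𝓝 0)

end

end UCB

/-! Put r = 1/√n⋆ and δ_a = Δ_a/√(2 log T). The equation for n⋆ says that the predicted counts (r +
δ_a)⁻² sum to T, as the actual counts n_a do.

Suppose every sample mean is accurate up to a fraction ε of its bonus. Comparing indices at the last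
pull of b gives (1-ε)/√n_a - δ_a ≤ (1+ε)/√(n_b - 1) - δ_b whenever n_b ≥ 2 (`balance_of_accurate`).
With a best arm as pivot, every n_b is (R + δ_b)⁻² up to a factor near 1 and an additive 1, where R
= 1/√n for the pivot's count n. Since a fraction α of the arms is near-optimal, moving R away from r
by a factor 1 ± η changes ∑ (R + δ_b)⁻² by a definite factor (`sum_shift_le`, `le_sum_shift`). Both
sums being T, and the additive terms only K = o(T), R must be close to r (`count_bounds`).

Accuracy holds for all arms and rounds at once by Ville's inequality for exponential
supermartingales, applied on dyadic blocks of the pull count (`measure_deviation_le`). The failure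
probability is of order K · log T · T^(-c) with c > 0, and K = T^o(1).

The additive 1 costs a relative error (r + δ_a)². It vanishes when δ_a → 0, because r² ≤ K/T → 0. -/

namespace UCB

/-! ### Deterministic stability of approximately balanced counts -/

/-- If a fraction `α` of the weights `(r + δ a)⁻²` has `δ a ≤ B * r`, these weights carry at least
the fraction `α` of the total. -/
theorem mul_sum_le_sum_near {ι : Type*} [Fintype ι] [Nonempty ι] {δ : ι → ℝ} (hδ : ∀ a, 0 ≤ δ a)
    {r B α : ℝ} (hr : 0 < r) (hB : 0 < B) (hα0 : 0 ≤ α)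
    (hα : α * Fintype.card ι ≤ (Finset.univ.filter (fun a => δ a ≤ B * r)).card) :
    α * ∑ a, ((r + δ a) ^ 2)⁻¹ ≤
      ∑ a ∈ Finset.univ.filter (fun a => δ a ≤ B * r), ((r + δ a) ^ 2)⁻¹ := by
  classical
  set G := Finset.univ.filter (fun a => δ a ≤ B * r) with hG
  have hcard : (0 : ℝ) < Fintype.card ι := by exact_mod_cast Fintype.card_pos
  have hGc : (G.card : ℝ) ≤ Fintype.card ι := by exact_mod_cast Finset.card_le_univ G
  have hα1 : α ≤ 1 := by
    by_contra! h
    nlinarith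
  -- The weight at the threshold δ = B r: near weights are at least `v`, far ones at most `v`, so
  -- the near average dominates the total average.
  set v : ℝ := (((1 + B) * r) ^ 2)⁻¹ with hv
  have hv0 : 0 ≤ v := by positivity
  have h1 : (G.card : ℝ) * v ≤ ∑ a ∈ G, ((r + δ a) ^ 2)⁻¹ := by
    rw [← nsmul_eq_mul]
    refine Finset.card_nsmul_le_sum _ _ _ fun a ha => ?_
    have ha' : δ a ≤ B * r := by simpa [hG] using ha
    have := hδ a
    rw [hv]
    gcongr
    linarith
  have h2 : ∑ a ∈ Gᶜ, ((r + δ a) ^ 2)⁻¹ ≤ (Fintype.card ι - G.card : ℝ) * v := by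
    have : ((Gᶜ).card : ℝ) = Fintype.card ι - G.card := by
      rw [Finset.card_compl, Nat.cast_sub (Finset.card_le_univ G)]
    rw [← this, ← nsmul_eq_mul]
    refine Finset.sum_le_card_nsmul _ _ _ fun a ha => ?_
    have ha' : B * r < δ a := by simpa [hG] using ha
    rw [hv]
    gcongr
    linarith
  rw [← Finset.sum_add_sum_compl G]
  have h3 := mul_le_mul_of_nonneg_left h2 hα0
  have h4 := mul_le_mul_of_nonneg_left h1 (sub_nonneg.2 hα1)
  have h5 := mul_le_mul_of_nonneg_right hα hv0
  linarith

/-- The ratio (r + δ)/(l r + δ) is monotone in δ, increasing for l ≥ 1 and decreasing for l ≤ 1. On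
δ ≤ B r its extreme value is therefore (1 + B)/(l + B), the constant in the two shift lemmas. -/
theorem inv_sq_shift_eq {r δ l : ℝ} (hr : 0 < r) (hl : 0 < l) (hδ : 0 ≤ δ) :
    ((l * r + δ) ^ 2)⁻¹ = ((r + δ) / (l * r + δ)) ^ 2 * ((r + δ) ^ 2)⁻¹ := by
  have : 0 < l * r + δ := by positivity
  have : 0 < r + δ := by positivity
  field_simp

/-- Increasing `r` by a factor decreases `∑ (r + δ a)⁻²` by a factor. -/
theorem sum_shift_le {ι : Type*} [Fintype ι] [Nonempty ι] {δ : ι → ℝ} (hδ : ∀ a, 0 ≤ δ a)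
    {r B α l : ℝ} (hr : 0 < r) (hB : 0 < B) (hα0 : 0 ≤ α) (hl : 1 ≤ l)
    (hα : α * Fintype.card ι ≤ (Finset.univ.filter (fun a => δ a ≤ B * r)).card) :
    ∑ a, ((l * r + δ a) ^ 2)⁻¹ ≤
      (1 - α * (1 - ((1 + B) / (l + B)) ^ 2)) * ∑ a, ((r + δ a) ^ 2)⁻¹ := by
  classical
  have key := mul_sum_le_sum_near hδ hr hB hα0 hα
  set G := Finset.univ.filter (fun a => δ a ≤ B * r) with hG
  set q : ℝ := (1 + B) / (l + B) with hq
  have hq1 : q ≤ 1 := by rw [hq, div_le_one (by linarith)]; linarith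
  have hq0 : 0 ≤ q := by positivity
  have h1 : ∑ a ∈ G, ((l * r + δ a) ^ 2)⁻¹ ≤ q ^ 2 * ∑ a ∈ G, ((r + δ a) ^ 2)⁻¹ := by
    rw [Finset.mul_sum]
    refine Finset.sum_le_sum fun a ha => ?_
    have ha' : δ a ≤ B * r := by simpa [hG] using ha
    have := hδ a
    rw [inv_sq_shift_eq hr (by linarith) (hδ a)]
    gcongr
    rw [hq, div_le_div_iff₀ (by positivity) (by positivity)]
    nlinarith [mul_nonneg (sub_nonneg.2 hl) (sub_nonneg.2 ha')]
  have h2 : ∑ a ∈ Gᶜ, ((l * r + δ a) ^ 2)⁻¹ ≤ ∑ a ∈ Gᶜ, ((r + δ a) ^ 2)⁻¹ := by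
    refine Finset.sum_le_sum fun a _ => ?_
    have := hδ a
    gcongr
    nlinarith
  have h3 := Finset.sum_add_sum_compl G (fun a => ((r + δ a) ^ 2)⁻¹)
  rw [← Finset.sum_add_sum_compl G (fun a => ((l * r + δ a) ^ 2)⁻¹)]
  have h4 : 0 ≤ 1 - q ^ 2 := by nlinarith
  linarith [mul_le_mul_of_nonneg_left key h4]

/-- Decreasing `r` by a factor increases `∑ (r + δ a)⁻²` by a factor. -/
theorem le_sum_shift {ι : Type*} [Fintype ι] [Nonempty ι] {δ : ι → ℝ} (hδ : ∀ a, 0 ≤ δ a)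
    {r B α l : ℝ} (hr : 0 < r) (hB : 0 < B) (hα0 : 0 ≤ α) (hl0 : 0 < l) (hl : l ≤ 1)
    (hα : α * Fintype.card ι ≤ (Finset.univ.filter (fun a => δ a ≤ B * r)).card) :
    (1 + α * (((1 + B) / (l + B)) ^ 2 - 1)) * ∑ a, ((r + δ a) ^ 2)⁻¹ ≤
      ∑ a, ((l * r + δ a) ^ 2)⁻¹ := by
  classical
  have key := mul_sum_le_sum_near hδ hr hB hα0 hα
  set G := Finset.univ.filter (fun a => δ a ≤ B * r) with hG
  set q : ℝ := (1 + B) / (l + B) with hq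
  have hq1 : 1 ≤ q := by rw [hq, one_le_div (by linarith)]; linarith
  have h1 : q ^ 2 * ∑ a ∈ G, ((r + δ a) ^ 2)⁻¹ ≤ ∑ a ∈ G, ((l * r + δ a) ^ 2)⁻¹ := by
    rw [Finset.mul_sum]
    refine Finset.sum_le_sum fun a ha => ?_
    have ha' : δ a ≤ B * r := by simpa [hG] using ha
    have := hδ a
    rw [inv_sq_shift_eq hr hl0 (hδ a)]
    gcongr
    rw [hq, div_le_div_iff₀ (by positivity) (by positivity)]
    nlinarith [mul_nonneg (sub_nonneg.2 hl) (sub_nonneg.2 ha')]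
  have h2 : ∑ a ∈ Gᶜ, ((r + δ a) ^ 2)⁻¹ ≤ ∑ a ∈ Gᶜ, ((l * r + δ a) ^ 2)⁻¹ := by
    refine Finset.sum_le_sum fun a _ => ?_
    have := hδ a
    gcongr
    nlinarith
  have h3 := Finset.sum_add_sum_compl G (fun a => ((r + δ a) ^ 2)⁻¹)
  rw [← Finset.sum_add_sum_compl G (fun a => ((l * r + δ a) ^ 2)⁻¹)]
  have h4 : 0 ≤ q ^ 2 - 1 := by nlinarith
  linarith [mul_le_mul_of_nonneg_left key h4]

set_option maxHeartbeats 1000000 in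
/-- Pull counts that satisfy the approximate balance `H` are close to `(r + δ a)⁻²`. -/
theorem count_bounds {ι : Type*} [Fintype ι] {δ : ι → ℝ} (hδ : ∀ a, 0 ≤ δ a)
    {n : ι → ℝ} (hn : ∀ a, n a = 1 ∨ 2 ≤ n a) {i : ι} (hi : δ i = 0)
    {r B α ε η κ T : ℝ} (hr : 0 < r) (hB : 0 < B) (hα0 : 0 ≤ α) (hT : 0 < T) (hε : 0 < ε) (hε1 : ε < 1)
    (hη : 0 < η) (hη1 : η < 1)
    (hα : α * Fintype.card ι ≤ (Finset.univ.filter (fun a => δ a ≤ B * r)).card)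
    (hsum : ∑ a, ((r + δ a) ^ 2)⁻¹ = T) (hnsum : ∑ a, n a = T)
    (H : ∀ b, 2 ≤ n b → ∀ a,
      (1 - ε) / √(n a) - δ a ≤ (1 + ε) / √(n b - 1) - δ b)
    (hκ : Fintype.card ι ≤ κ * T) (hκr : κ * (2 * (1 + η) ^ 2) ≤ 1)
    (hκη : κ * (1 + η) ^ 2 ≤ 1 - (1 - η) ^ 2)
    (hup : κ + ((1 + ε) / (1 - ε)) ^ 2 *
      (1 - α * (1 - ((1 + B) / (1 + η + B)) ^ 2)) < 1)
    (hlo : ((1 + ε) / (1 - ε)) ^ 2 < 1 + α * (((1 + B) / (1 - η + B)) ^ 2 - 1)) (a : ι) :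
    n a ≤ 1 + (((1 + ε) / (1 - ε)) ^ 2 * (((1 - η) ^ 2) ^ 2)⁻¹) * ((r + δ a) ^ 2)⁻¹ ∧
    ((((1 + ε) / (1 - ε)) ^ 2)⁻¹ * ((1 - η) / (1 + η)) ^ 2) * ((r + δ a) ^ 2)⁻¹ ≤ n a := by
  have : Nonempty ι := ⟨i⟩
  have hn1 : ∀ a, 1 ≤ n a := fun a => by rcases hn a with h | h <;> linarith
  set θ := (1 + ε) / (1 - ε) with hθ
  have hε' : 0 < 1 - ε := by linarith
  have hθ0 : 0 < θ := by positivity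
  have hθε : 1 + ε = θ * (1 - ε) := by rw [hθ]; field_simp
  set R := 1 / √(n i) with hR
  have hni : 0 < √(n i) := Real.sqrt_pos.2 (by linarith [hn1 i])
  have hR0 : 0 < R := by positivity
  have hR2 : R ^ 2 * n i = 1 := by
    rw [hR, div_pow, Real.sq_sqrt (by linarith [hn1 i])]
    have := hn1 i
    field_simp
  -- upper bounds for the counts
  have hA : ∀ b, n b ≤ 1 + θ ^ 2 * ((R + δ b) ^ 2)⁻¹ := by
    intro b
    have hb := hδ b
    rcases hn b with h | h
    · rw [h]; simp; positivity
    · have h1 := H b h i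
      have hs : 0 < √(n b - 1) := Real.sqrt_pos.2 (by linarith)
      have h2 : (1 - ε) * (R + δ b) ≤ (1 - ε) * (θ / √(n b - 1)) := by
        have : (1 - ε) / √(n i) = (1 - ε) * R := by rw [hR]; ring
        rw [this, hi, hθε] at h1
        have h4 : θ * (1 - ε) / √(n b - 1) = (1 - ε) * (θ / √(n b - 1)) := by ring
        nlinarith
      have h3 : R + δ b ≤ θ / √(n b - 1) := le_of_mul_le_mul_left h2 hε'
      have h5 : √(n b - 1) ≤ θ / (R + δ b) := by
        rw [le_div_iff₀ hs] at h3
        rw [le_div_iff₀ (by positivity)]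
        linarith
      have h6 : n b - 1 ≤ (θ / (R + δ b)) ^ 2 := by
        rw [← Real.sq_sqrt (show 0 ≤ n b - 1 by linarith)]
        gcongr
      rw [div_pow, div_eq_mul_inv] at h6
      linarith
  -- Otherwise the upper bounds `hA` would sum to less than T, by `sum_shift_le` and `hup`.
  have hRr : R ≤ (1 + η) * r := by
    by_contra! h
    have h1 : T ≤ Fintype.card ι + θ ^ 2 * ∑ b, ((R + δ b) ^ 2)⁻¹ := by
      rw [← hnsum, Finset.mul_sum]
      refine (Finset.sum_le_sum fun b _ => hA b).trans ?_
      rw [Finset.sum_add_distrib]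
      simp
    have h2 : ∑ b, ((R + δ b) ^ 2)⁻¹ ≤ ∑ b, (((1 + η) * r + δ b) ^ 2)⁻¹ := by
      refine Finset.sum_le_sum fun b _ => ?_
      have := hδ b
      gcongr
    have h3 := sum_shift_le hδ hr hB hα0 (l := 1 + η) (by linarith) hα
    rw [hsum] at h3
    have h4 := mul_le_mul_of_nonneg_left (h2.trans h3) (sq_nonneg θ)
    have h5 := mul_lt_mul_of_pos_right hup hT
    clear_value θ R
    linarith
  -- the best arm is pulled often
  have hrκ : r ^ 2 ≤ κ := by
    have h1 : T ≤ Fintype.card ι * (r ^ 2)⁻¹ := by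
      rw [← hsum, ← nsmul_eq_mul]
      refine Finset.sum_le_card_nsmul _ _ _ fun b _ => ?_
      have := hδ b
      gcongr
      linarith
    rw [← div_eq_mul_inv, le_div_iff₀ (by positivity)] at h1
    have : T * r ^ 2 ≤ T * κ := by linarith
    exact le_of_mul_le_mul_left this hT
  have hRκ : R ^ 2 ≤ κ * (1 + η) ^ 2 := by
    have h1 : R ^ 2 ≤ ((1 + η) * r) ^ 2 := by gcongr
    have h2 := mul_le_mul_of_nonneg_right hrκ (sq_nonneg (1 + η))
    linarith
  -- Needed to use balance with `i` in the role of `b`: R² n_i = 1 while R² ≤ 1/2.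
  have hni2 : 2 ≤ n i := by
    have h1 := mul_le_mul_of_nonneg_right hRκ (show 0 ≤ n i by linarith [hn1 i])
    by_contra! h
    have h2 : κ * (1 + η) ^ 2 * n i ≤ 1 / 2 * n i := by
      refine mul_le_mul_of_nonneg_right ?_ (by linarith [hn1 i])
      linarith
    linarith
  set R' := 1 / √(n i - 1) with hR'
  have hs1 : 0 < √(n i - 1) := Real.sqrt_pos.2 (by linarith)
  have hR'0 : 0 < R' := by positivity
  -- Losing one pull of the best arm changes 1/√n_i by a factor at most 1/(1-η), since 1/n_i = R² ≤
  -- 1 - (1-η)².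
  have hRR' : (1 - η) * R' ≤ R := by
    rw [hR', hR, mul_one_div, div_le_div_iff₀ hs1 hni, one_mul]
    refine Real.le_sqrt_of_sq_le ?_
    rw [mul_pow, Real.sq_sqrt (by linarith)]
    have h1 := mul_le_mul_of_nonneg_right (hRκ.trans hκη) (show 0 ≤ n i by linarith)
    linarith
  -- lower bounds for the counts
  have hC : ∀ b, (θ ^ 2)⁻¹ * ((R' + δ b) ^ 2)⁻¹ ≤ n b := by
    intro b
    have hb := hδ b
    have h1 := H i hni2 b
    have hs : 0 < √(n b) := Real.sqrt_pos.2 (by linarith [hn1 b])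
    have h2 : (1 - ε) * (1 / √(n b)) ≤ (1 - ε) * (θ * (R' + δ b)) := by
      have e1 : (1 + ε) / √(n i - 1) = (1 - ε) * (θ * R') := by rw [hθε, hR']; ring
      rw [e1, hi] at h1
      have e2 : (1 - ε) / √(n b) = (1 - ε) * (1 / √(n b)) := by ring
      have e3 : δ b ≤ (1 - ε) * (θ * δ b) := by
        have : (1 - ε) * (θ * δ b) = (1 + ε) * δ b := by rw [hθε]; ring
        rw [this]; nlinarith
      linarith
    have h3 := le_of_mul_le_mul_left h2 hε'
    rw [div_le_iff₀ hs] at h3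
    have h4 : 1 ≤ (θ * (R' + δ b) * √(n b)) ^ 2 := one_le_pow₀ h3
    rw [mul_pow, mul_pow, Real.sq_sqrt (by linarith [hn1 b])] at h4
    rw [← mul_inv, inv_le_iff_one_le_mul₀ (by positivity)]
    linarith
  -- Otherwise the lower bounds `hC` would sum to more than T, by `le_sum_shift` and `hlo`.
  have hR'r : (1 - η) * r ≤ R' := by
    by_contra! h
    have h1 : (θ ^ 2)⁻¹ * ∑ b, ((R' + δ b) ^ 2)⁻¹ ≤ T := by
      rw [← hnsum, Finset.mul_sum]
      exact Finset.sum_le_sum fun b _ => hC b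
    have h2 : ∑ b, (((1 - η) * r + δ b) ^ 2)⁻¹ ≤ ∑ b, ((R' + δ b) ^ 2)⁻¹ := by
      refine Finset.sum_le_sum fun b _ => ?_
      have := hδ b
      gcongr
    have h3 := le_sum_shift hδ hr hB hα0 (l := 1 - η) (by linarith) (by linarith) hα
    rw [hsum] at h3
    rw [inv_mul_le_iff₀ (by positivity)] at h1
    have h5 := mul_lt_mul_of_pos_right hlo hT
    linarith
  have ha := hδ a
  have h1η : 0 < 1 - η := by linarith
  constructor
  · refine (hA a).trans ?_
    rw [mul_assoc, ← mul_inv, ← mul_pow]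
    gcongr
    -- R ≥ (1-η) R' ≥ (1-η)² r; squaring in the count gives the fourth power of 1-η.
    have h1 := mul_le_mul_of_nonneg_left hR'r h1η.le
    have h2 : (1 - η) ^ 2 * δ a ≤ δ a := mul_le_of_le_one_left ha (by nlinarith)
    linarith
  · refine le_trans ?_ (hC a)
    rw [mul_assoc]
    have e : ((1 - η) / (1 + η)) ^ 2 * ((r + δ a) ^ 2)⁻¹
        = (((1 + η) / (1 - η) * (r + δ a)) ^ 2)⁻¹ := by
      have : 0 < r + δ a := by positivity
      field_simp
    rw [e]
    gcongr
    have h1 : R' ≤ (1 + η) / (1 - η) * r := by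
      rw [div_mul_eq_mul_div, le_div_iff₀ h1η]
      linarith
    have h2 : 1 ≤ (1 + η) / (1 - η) := by rw [one_le_div h1η]; linarith
    have h3 := mul_le_mul_of_nonneg_right h2 ha
    linarith

/-- The tolerances under which approximately balanced pull counts are within `τ` of
`(r + δ a)⁻²`. -/
theorem exists_tolerance {B α τ : ℝ} (hB : 0 < B) (hα : 0 < α) (hτ : 0 < τ) :
    ∃ ε κ : ℝ, 0 < ε ∧ ε < 1 ∧ 0 < κ ∧
    ∀ {ι : Type} [Fintype ι] {δ : ι → ℝ} (_ : ∀ a, 0 ≤ δ a)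
    {n : ι → ℝ} (_ : ∀ a, n a = 1 ∨ 2 ≤ n a) {i : ι} (_ : δ i = 0)
    {r T : ℝ} (_ : 0 < r) (_ : 0 < T)
    (_ : α * Fintype.card ι ≤ (Finset.univ.filter (fun a => δ a ≤ B * r)).card)
    (_ : ∑ a, ((r + δ a) ^ 2)⁻¹ = T) (_ : ∑ a, n a = T)
    (_ : ∀ b, 2 ≤ n b → ∀ a,
      (1 - ε) / √(n a) - δ a ≤ (1 + ε) / √(n b - 1) - δ b)
    (_ : Fintype.card ι ≤ κ * T) (a : ι),
    |n a / ((r + δ a) ^ 2)⁻¹ - 1| ≤ τ + (r + δ a) ^ 2 := by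
  have hup : ∀ᶠ η : ℝ in 𝓝[>] 0, (((1 - η) ^ 2) ^ 2)⁻¹ < 1 + τ := by
    have : Tendsto (fun η : ℝ => (((1 - η) ^ 2) ^ 2)⁻¹) (𝓝[>] 0) (𝓝 (((1 - 0) ^ 2) ^ 2)⁻¹) := by
      refine ContinuousAt.continuousWithinAt ?_
      refine ContinuousAt.inv₀ (by fun_prop) (by norm_num)
    refine this.eventually_lt_const ?_
    norm_num; exact hτ
  have hlo : ∀ᶠ η : ℝ in 𝓝[>] 0, 1 - τ < ((1 - η) / (1 + η)) ^ 2 := by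
    have : Tendsto (fun η : ℝ => ((1 - η) / (1 + η)) ^ 2) (𝓝[>] 0) (𝓝 (((1 - 0) / (1 + 0)) ^ 2)) := by
      refine ContinuousAt.continuousWithinAt ?_
      refine ContinuousAt.pow (ContinuousAt.div (by fun_prop) (by fun_prop) (by norm_num)) 2
    refine this.eventually_const_lt ?_
    norm_num; exact hτ
  have hlt : ∀ᶠ η : ℝ in 𝓝[>] 0, η < 1 :=
    Filter.Eventually.filter_mono nhdsWithin_le_nhds (eventually_lt_nhds one_pos)
  -- η depends on τ only. It fixes the gains `q` and `p` of the shift lemmas, and ε is then chosen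
  -- small relative to them.
  obtain ⟨η, ⟨⟨hη1, hη2⟩, hη3⟩, hη0 : 0 < η⟩ :=
    (((hup.and hlo).and hlt).and self_mem_nhdsWithin).exists
  set q := 1 - ((1 + B) / (1 + η + B)) ^ 2 with hq
  have hq0 : 0 < q := by
    have : (1 + B) / (1 + η + B) < 1 := by rw [div_lt_one (by positivity)]; linarith
    have h0 : 0 ≤ (1 + B) / (1 + η + B) := by positivity
    nlinarith
  set p := ((1 + B) / (1 - η + B)) ^ 2 - 1 with hp
  have hp0 : 0 < p := by
    have : 1 < (1 + B) / (1 - η + B) := by rw [one_lt_div (by linarith)]; linarith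
    nlinarith
  have hθ : Tendsto (fun ε : ℝ => ((1 + ε) / (1 - ε)) ^ 2) (𝓝[>] 0)
      (𝓝 (((1 + 0) / (1 - 0)) ^ 2)) := by
    refine ContinuousAt.continuousWithinAt ?_
    refine ContinuousAt.pow (ContinuousAt.div (by fun_prop) (by fun_prop) (by norm_num)) 2
  have e1 : ∀ᶠ ε : ℝ in 𝓝[>] 0, ((1 + ε) / (1 - ε)) ^ 2 < 1 + α * p := by
    refine hθ.eventually_lt_const ?_
    norm_num; positivity
  -- Half of the slack αq absorbs θ² = ((1+ε)/(1-ε))²; the other half is left for κ.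
  have e2 : ∀ᶠ ε : ℝ in 𝓝[>] 0, ((1 + ε) / (1 - ε)) ^ 2 * (1 - α * q) < 1 - α * q / 2 := by
    refine (hθ.mul_const _).eventually_lt_const ?_
    have : 0 < α * q := by positivity
    norm_num; linarith
  have e3 : ∀ᶠ ε : ℝ in 𝓝[>] 0,
      ((1 + ε) / (1 - ε)) ^ 2 * (((1 - η) ^ 2) ^ 2)⁻¹ < 1 + τ := by
    refine (hθ.mul_const _).eventually_lt_const ?_
    norm_num; simpa using hη1
  have e4 : ∀ᶠ ε : ℝ in 𝓝[>] 0,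
      1 - τ < (((1 + ε) / (1 - ε)) ^ 2)⁻¹ * ((1 - η) / (1 + η)) ^ 2 := by
    refine ((hθ.inv₀ (by norm_num)).mul_const _).eventually_const_lt ?_
    norm_num; simpa using hη2
  have e5 : ∀ᶠ ε : ℝ in 𝓝[>] 0, ε < 1 :=
    Filter.Eventually.filter_mono nhdsWithin_le_nhds (eventually_lt_nhds one_pos)
  obtain ⟨ε, ⟨⟨⟨⟨h1, h2⟩, h3⟩, h4⟩, h5⟩, hε0 : 0 < ε⟩ :=
    (((((e1.and e2).and e3).and e4).and e5).and self_mem_nhdsWithin).exists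
  have h1η : 0 < 1 - (1 - η) ^ 2 := by nlinarith
  refine ⟨ε, min (α * q / 2) (min (1 / (2 * (1 + η) ^ 2)) ((1 - (1 - η) ^ 2) / (1 + η) ^ 2)),
    hε0, h5, by positivity, ?_⟩
  intro ι _ δ hδ n hn i hi r T hr hT hα' hsum hnsum H hκ a
  set κ := min (α * q / 2) (min (1 / (2 * (1 + η) ^ 2)) ((1 - (1 - η) ^ 2) / (1 + η) ^ 2)) with hκd
  have k1 : κ ≤ α * q / 2 := min_le_left _ _
  have k2 : κ ≤ 1 / (2 * (1 + η) ^ 2) := (min_le_right _ _).trans (min_le_left _ _)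
  have k3 : κ ≤ (1 - (1 - η) ^ 2) / (1 + η) ^ 2 := (min_le_right _ _).trans (min_le_right _ _)
  obtain ⟨hU, hL⟩ := count_bounds hδ hn hi hr hB hα.le hT hε0 h5 hη0 hη3 hα' hsum hnsum H hκ
    ((le_div_iff₀ (by positivity)).1 k2) ((le_div_iff₀ (by positivity)).1 k3)
    (by linarith) (by linarith) a
  have ha := hδ a
  have hw : 0 < r + δ a := by positivity
  set w := ((r + δ a) ^ 2)⁻¹ with hwd
  have hw0 : 0 < w := by positivity
  have hw1 : (r + δ a) ^ 2 * w = 1 := by rw [hwd]; field_simp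
  have hsq : 0 ≤ (r + δ a) ^ 2 := sq_nonneg _
  rw [abs_le]
  constructor
  · have : 1 - τ ≤ n a / w := by
      rw [le_div_iff₀ hw0]
      exact (mul_le_mul_of_nonneg_right h4.le hw0.le).trans hL
    linarith
  -- Dividing the additive 1 by the predicted count `w` produces the term (r + δ_a)².
  · have : n a / w ≤ (r + δ a) ^ 2 + (1 + τ) := by
      rw [div_le_iff₀ hw0, add_mul, hw1]
      exact hU.trans (by gcongr)
    linarith

end UCB

/-! ### Concentration of the sample means, uniformly over arms and rounds -/

namespace UCB

/-- Sum of the centred rewards of arm `a` in rounds `1, …, t`. -/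
noncomputable def excess {Ω : Type*} {K : ℕ} (A : ℕ → Ω → Fin K) (X : ℕ → Ω → ℝ) (μ : ℝ)
    (a : Fin K) (t : ℕ) (ω : Ω) : ℝ :=
  ∑ s ∈ (Finset.Icc 1 t).filter (fun s => A s ω = a), (X s ω - μ)

/-- The exponential supermartingale of arm `a`. -/
noncomputable def expMart {Ω : Type*} {K : ℕ} (A : ℕ → Ω → Fin K) (X : ℕ → Ω → ℝ) (μ s c : ℝ)
    (a : Fin K) (t : ℕ) (ω : Ω) : ℝ≥0∞ :=
  ENNReal.ofReal (Real.exp (s * excess A X μ a t ω - c * pulls A a t ω))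

section Deterministic

variable {Ω : Type*} {K : ℕ} (A : ℕ → Ω → Fin K) (X : ℕ → Ω → ℝ) (μ : ℝ) (a : Fin K)

theorem pulls_succ (t : ℕ) (ω : Ω) :
    pulls A a (t + 1) ω = pulls A a t ω + if A (t + 1) ω = a then 1 else 0 := by
  simp only [pulls, Finset.card_filter]
  rw [Finset.sum_Icc_succ_top (by omega)]

theorem excess_succ (t : ℕ) (ω : Ω) :
    excess A X μ a (t + 1) ω =
      excess A X μ a t ω + if A (t + 1) ω = a then X (t + 1) ω - μ else 0 := by
  simp only [excess, Finset.sum_filter]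
  rw [Finset.sum_Icc_succ_top (by omega)]

theorem pulls_mono (ω : Ω) : Monotone fun t => pulls A a t ω :=
  monotone_nat_of_le_succ fun t => by rw [pulls_succ]; omega

theorem pulls_le (t : ℕ) (ω : Ω) : pulls A a t ω ≤ t := by
  simpa [pulls] using Finset.card_filter_le (Finset.Icc 1 t) (fun s => A s ω = a)

theorem sum_pulls (t : ℕ) (ω : Ω) : ∑ a, pulls A a t ω = t := by
  have := Finset.card_eq_sum_card_fiberwise (f := fun s => A s ω) (s := Finset.Icc 1 t)
    (t := Finset.univ) (fun _ _ => by simp)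
  simp only [Nat.card_Icc, Nat.add_sub_cancel] at this
  exact this.symm

theorem sampleMean_sub (t : ℕ) (ω : Ω) (h : 0 < pulls A a t ω) :
    sampleMean A X a t ω - μ = excess A X μ a t ω / pulls A a t ω := by
  have : (pulls A a t ω : ℝ) ≠ 0 := by exact_mod_cast h.ne'
  rw [sampleMean, excess, Finset.sum_sub_distrib, Finset.sum_const, nsmul_eq_mul]
  change _ = (_ - (pulls A a t ω : ℝ) * μ) / _
  field_simp

/-- An arm that was pulled after round `s` has a last pull. -/
theorem exists_last_pull {s : ℕ} (ω : Ω) (t : ℕ) (hst : s ≤ t)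
    (h : pulls A a s ω < pulls A a t ω) :
    ∃ u, s ≤ u ∧ u < t ∧ A (u + 1) ω = a ∧ pulls A a u ω + 1 = pulls A a t ω := by
  induction t, hst using Nat.le_induction with
  | base => omega
  | succ t hst ih =>
    rw [pulls_succ] at h ⊢
    by_cases hA : A (t + 1) ω = a
    · exact ⟨t, hst, by omega, hA, by simp [hA]⟩
    · simp only [hA, if_false, add_zero] at h ⊢
      obtain ⟨u, h1, h2, h3, h4⟩ := ih h
      exact ⟨u, h1, by omega, h3, h4⟩

end Deterministic

variable {Ω : Type*} [m : MeasurableSpace Ω] {P : Measure Ω} {K T : ℕ}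
  {ν : Fin K → Measure ℝ} {ℱ : Filtration ℕ m} {A : ℕ → Ω → Fin K} {X : ℕ → Ω → ℝ}

namespace IsUCBRun

theorem measurable_arm_le (h : IsUCBRun P T ν ℱ A X) {s t : ℕ} (hs : 1 ≤ s) (hst : s ≤ t)
    (ht : t ≤ T) : Measurable[ℱ t] (A s) := by
  obtain ⟨s, rfl⟩ := Nat.exists_eq_add_of_le' hs
  exact (h.arm_measurable s (by omega)).mono (ℱ.mono (by omega)) le_rfl

theorem measurable_reward_le (h : IsUCBRun P T ν ℱ A X) {s t : ℕ} (hs : 1 ≤ s) (hst : s ≤ t)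
    (ht : t ≤ T) : Measurable[ℱ t] (X s) := by
  obtain ⟨s, rfl⟩ := Nat.exists_eq_add_of_le' hs
  exact (h.reward_measurable s (by omega)).mono (ℱ.mono (by omega)) le_rfl

theorem measurable_excess (h : IsUCBRun P T ν ℱ A X) (μ : ℝ) (a : Fin K) {t : ℕ} (ht : t ≤ T) :
    Measurable[ℱ t] (excess A X μ a t) := by
  unfold excess
  simp only [Finset.sum_filter]
  refine Finset.measurable_sum _ fun s hs => ?_
  rw [Finset.mem_Icc] at hs
  have h1 : MeasurableSet[ℱ t] {ω | A s ω = a} :=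
    h.measurable_arm_le hs.1 hs.2 ht (measurableSet_singleton a)
  exact Measurable.ite h1 ((h.measurable_reward_le hs.1 hs.2 ht).sub_const _) measurable_const

theorem measurable_pulls (h : IsUCBRun P T ν ℱ A X) (a : Fin K) {t : ℕ} (ht : t ≤ T) :
    Measurable[ℱ t] (fun ω => (pulls A a t ω : ℝ)) := by
  unfold pulls
  simp only [Finset.card_filter, Nat.cast_sum]
  refine Finset.measurable_sum _ fun s hs => ?_
  rw [Finset.mem_Icc] at hs
  have h1 : MeasurableSet[ℱ t] {ω | A s ω = a} :=
    h.measurable_arm_le hs.1 hs.2 ht (measurableSet_singleton a)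
  simp only [Nat.cast_ite]
  exact Measurable.ite h1 measurable_const measurable_const

theorem measurable_expMart (h : IsUCBRun P T ν ℱ A X) (μ s c : ℝ) (a : Fin K) {t : ℕ}
    (ht : t ≤ T) : Measurable[ℱ t] (expMart A X μ s c a t) :=
  ENNReal.measurable_ofReal.comp (Real.measurable_exp.comp
    (((h.measurable_excess μ a ht).const_mul s).sub ((h.measurable_pulls a ht).const_mul c)))

/-- The reward of the next round is integrated against the law of the chosen arm. -/
theorem setLIntegral_mul_reward (h : IsUCBRun P T ν ℱ A X) {t : ℕ}
    (ht : t < T) (a : Fin K) {f : ℝ → ℝ≥0∞} (hf : Measurable f) {g : Ω → ℝ≥0∞}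
    (hg : Measurable[ℱ t] g) :
    ∫⁻ ω in {ω | A (t + 1) ω = a}, g ω * f (X (t + 1) ω) ∂P =
      (∫⁻ ω in {ω | A (t + 1) ω = a}, g ω ∂P) * ∫⁻ x, f x ∂ν a := by
  have hX : Measurable (X (t + 1)) := (h.reward_measurable t ht).mono (ℱ.le _) le_rfl
  have hA : MeasurableSet {ω | A (t + 1) ω = a} :=
    ℱ.le t _ (h.arm_measurable t ht (measurableSet_singleton a))
  have hfX : Measurable fun ω => f (X (t + 1) ω) := hf.comp hX
  -- `reward_law` speaks of events only; it extends to all nonnegative `ℱ t`-measurable `g` through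
  -- indicators, sums and monotone limits.
  refine @Measurable.ennreal_induction Ω (ℱ t) (fun g =>
    ∫⁻ ω in {ω | A (t + 1) ω = a}, g ω * f (X (t + 1) ω) ∂P =
      (∫⁻ ω in {ω | A (t + 1) ω = a}, g ω ∂P) * ∫⁻ x, f x ∂ν a) ?_ ?_ ?_ g hg
  · intro c D hD
    have hD' : MeasurableSet D := ℱ.le t _ hD
    have hmap : (P.restrict (D ∩ {ω | A (t + 1) ω = a})).map (X (t + 1)) =
        P (D ∩ {ω | A (t + 1) ω = a}) • ν a := by
      ext S hS
      rw [Measure.map_apply hX hS, Measure.restrict_apply (hX hS), Measure.smul_apply, smul_eq_mul,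
        ← h.reward_law t ht a D hD S hS, Set.inter_comm]
      rfl
    have e : ∀ ω, D.indicator (fun _ => c) ω * f (X (t + 1) ω) =
        D.indicator (fun ω => c * f (X (t + 1) ω)) ω := fun ω => by
      by_cases hω : ω ∈ D <;> simp [hω]
    simp only [e]
    rw [lintegral_indicator hD', lintegral_indicator hD', Measure.restrict_restrict hD',
      lintegral_const_mul _ hfX, ← lintegral_map hf hX, hmap, lintegral_smul_measure,
      lintegral_const, Measure.restrict_apply_univ, smul_eq_mul, mul_assoc]
  · intro g₁ g₂ _ h₁ h₂ i₁ i₂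
    have h₁' := h₁.mono (ℱ.le t) le_rfl
    simp only [Pi.add_apply, add_mul]
    have hm : Measurable fun ω => g₁ ω * f (X (t + 1) ω) := h₁'.mul hfX
    rw [lintegral_add_left hm, lintegral_add_left h₁', i₁, i₂, add_mul]
  · intro g hg hmono ih
    have hg' := fun n => (hg n).mono (ℱ.le t) le_rfl
    simp only [ENNReal.iSup_mul]
    have hm : ∀ n, Measurable fun ω => g n ω * f (X (t + 1) ω) := fun n => (hg' n).mul hfX
    rw [lintegral_iSup hm (fun i j hij ω => mul_le_mul_left (hmono hij ω) _),
      lintegral_iSup hg' hmono, ENNReal.iSup_mul]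
    simp only [ih]

/-- `expMart` is a supermartingale. -/
theorem setLIntegral_expMart_succ_le (h : IsUCBRun P T ν ℱ A X) {t : ℕ}
    (ht : t < T) (a : Fin K) {μ s c : ℝ}
    (hmgf : ∫⁻ x, ENNReal.ofReal (Real.exp (s * (x - μ) - c)) ∂ν a ≤ 1) {D : Set Ω}
    (hD : MeasurableSet[ℱ t] D) :
    ∫⁻ ω in D, expMart A X μ s c a (t + 1) ω ∂P ≤ ∫⁻ ω in D, expMart A X μ s c a t ω ∂P := by
  have hA : MeasurableSet {ω | A (t + 1) ω = a} :=
    ℱ.le t _ (h.arm_measurable t ht (measurableSet_singleton a))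
  have hD' : MeasurableSet D := ℱ.le t _ hD
  have hM := h.measurable_expMart μ s c a ht.le
  rw [← lintegral_inter_add_sdiff _ D hA, ← lintegral_inter_add_sdiff (expMart A X μ s c a t) D hA]
  gcongr ?_ + ?_
  · have e : ∀ B : Ω → ℝ≥0∞, ∫⁻ ω in D ∩ {ω | A (t + 1) ω = a}, B ω ∂P =
        ∫⁻ ω in {ω | A (t + 1) ω = a}, D.indicator B ω ∂P := fun B => by
      rw [lintegral_indicator hD', Measure.restrict_restrict hD']
    rw [e, e]
    calc _ = ∫⁻ ω in {ω | A (t + 1) ω = a}, D.indicator (expMart A X μ s c a t) ω *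
          (fun x => ENNReal.ofReal (Real.exp (s * (x - μ) - c))) (X (t + 1) ω) ∂P := by
          refine setLIntegral_congr_fun hA fun ω (hω : A (t + 1) ω = a) => ?_
          by_cases hωD : ω ∈ D
          · simp only [hωD, Set.indicator_of_mem, expMart]
            rw [← ENNReal.ofReal_mul (Real.exp_nonneg _), ← Real.exp_add, excess_succ, pulls_succ,
              if_pos hω, if_pos hω]
            congr 2
            push_cast
            ring
          · simp [hωD]
      _ ≤ _ := by
          rw [h.setLIntegral_mul_reward ht a
            (f := fun x => ENNReal.ofReal (Real.exp (s * (x - μ) - c))) (by fun_prop)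
            (hM.indicator hD)]
          exact mul_le_of_le_one_right' hmgf
  · refine (setLIntegral_congr_fun (hD'.diff hA) fun ω hω => ?_).le
    have : A (t + 1) ω ≠ a := hω.2
    simp [expMart, excess_succ, pulls_succ, this]

/-- Ville's inequality for `expMart`. -/
theorem measure_exists_le_expMart [IsProbabilityMeasure P] (h : IsUCBRun P T ν ℱ A X)
    (a : Fin K) {μ s c : ℝ}
    (hmgf : ∫⁻ x, ENNReal.ofReal (Real.exp (s * (x - μ) - c)) ∂ν a ≤ 1) (x : ℝ≥0∞) :
    x * P {ω | ∃ t ≤ T, x ≤ expMart A X μ s c a t ω} ≤ 1 := by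
  have hmeas : ∀ t ≤ T, MeasurableSet[ℱ t] {ω | ∃ u ≤ t, x ≤ expMart A X μ s c a u ω} := by
    intro t ht
    have : {ω | ∃ u ≤ t, x ≤ expMart A X μ s c a u ω} =
        ⋃ u ∈ Set.Iic t, {ω | x ≤ expMart A X μ s c a u ω} := by ext; simp
    rw [this]
    refine MeasurableSet.biUnion (Set.to_countable _) fun u (hu : u ≤ t) => ?_
    exact ℱ.mono hu _ (h.measurable_expMart μ s c a (hu.trans ht) measurableSet_Ici)
  -- The left side bounds the mean of the process stopped on reaching level `x`: already crossed
  -- paths count `x`, the others their current value. It starts below 1 and cannot exceed 1 later,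
  -- so no stopping time is needed.
  suffices H : ∀ t ≤ T, x * P {ω | ∃ u ≤ t, x ≤ expMart A X μ s c a u ω} +
      ∫⁻ ω in {ω | ∃ u ≤ t, x ≤ expMart A X μ s c a u ω}ᶜ, expMart A X μ s c a t ω ∂P ≤ 1 from
    le_self_add.trans (H T le_rfl)
  have hstep : ∀ t ≤ T, ∀ E : Set Ω, MeasurableSet E →
      x * P (E ∩ {ω | x ≤ expMart A X μ s c a t ω}) +
        ∫⁻ ω in E \ {ω | x ≤ expMart A X μ s c a t ω}, expMart A X μ s c a t ω ∂P ≤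
      ∫⁻ ω in E, expMart A X μ s c a t ω ∂P := by
    intro t ht E hE
    have hS : MeasurableSet {ω | x ≤ expMart A X μ s c a t ω} :=
      ℱ.le t _ (h.measurable_expMart μ s c a ht measurableSet_Ici)
    rw [← lintegral_inter_add_sdiff (expMart A X μ s c a t) E hS]
    gcongr
    rw [← setLIntegral_const]
    exact setLIntegral_mono' (hE.inter hS) fun ω hω => hω.2
  intro t
  induction t with
  | zero =>
    intro h0
    have := hstep 0 h0 Set.univ MeasurableSet.univ
    rw [Set.univ_inter, ← Set.compl_eq_univ_sdiff] at this
    simp only [nonpos_iff_eq_zero, exists_eq_left]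
    refine this.trans ?_
    simp [expMart, excess, pulls]
  | succ t ih =>
    intro ht
    refine le_trans ?_ (ih (by omega))
    set E := {ω | ∃ u ≤ t, x ≤ expMart A X μ s c a u ω} with hE
    have hEm := hmeas t (by omega)
    set S := {ω | x ≤ expMart A X μ s c a (t + 1) ω} with hS
    have e : {ω | ∃ u ≤ t + 1, x ≤ expMart A X μ s c a u ω} = E ∪ (Eᶜ ∩ S) := by
      rw [Set.union_inter_distrib_left, Set.union_compl_self, Set.univ_inter]
      ext ω
      simp only [hE, hS, Set.mem_ofPred_eq, Set.mem_union, Nat.le_succ_iff]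
      constructor
      · rintro ⟨u, hu | rfl, h⟩
        · exact Or.inl ⟨u, hu, h⟩
        · exact Or.inr h
      · rintro (⟨u, hu, h⟩ | h)
        · exact ⟨u, Or.inl hu, h⟩
        · exact ⟨t + 1, Or.inr rfl, h⟩
    have e' : (E ∪ (Eᶜ ∩ S))ᶜ = Eᶜ \ S := by ext; simp; tauto
    rw [e, e']
    calc _ ≤ x * (P E + P (Eᶜ ∩ S)) + ∫⁻ ω in Eᶜ \ S, expMart A X μ s c a (t + 1) ω ∂P := by
          gcongr; exact measure_union_le _ _
      _ = x * P E + (x * P (Eᶜ ∩ S) +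
            ∫⁻ ω in Eᶜ \ S, expMart A X μ s c a (t + 1) ω ∂P) := by rw [mul_add, add_assoc]
      _ ≤ _ := by
          gcongr
          exact (hstep (t + 1) ht _ (ℱ.le t _ hEm).compl).trans
            (h.setLIntegral_expMart_succ_le (by omega) a hmgf hEm.compl)

end IsUCBRun

/-- Supplies the supermartingale condition with c = L²s²/2, the same for all arms because enlarging
the parameter only lowers the integrand. -/
theorem IsSubGaussian.lintegral_exp_le {lam L : ℝ≥0} {ρ : Measure ℝ} (h : IsSubGaussian lam ρ)
    (hL : lam ≤ L) (s : ℝ) :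
    ∫⁻ x, ENNReal.ofReal (Real.exp (s * (x - ∫ y, y ∂ρ) - L ^ 2 * s ^ 2 / 2)) ∂ρ ≤ 1 := by
  have h1 : ∀ x : ℝ, Real.exp (s * (x - ∫ y, y ∂ρ) - L ^ 2 * s ^ 2 / 2) =
      Real.exp (s * (x - ∫ y, y ∂ρ)) * Real.exp (-(L ^ 2 * s ^ 2 / 2)) := fun x => by
    rw [← Real.exp_add, sub_eq_add_neg]
  rw [← ofReal_integral_eq_lintegral_ofReal]
  · simp only [h1]
    rw [integral_mul_const]
    have h2 := h.mgf_le s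
    rw [mgf] at h2
    have h3 : ((lam ^ 2 : ℝ≥0) : ℝ) * s ^ 2 / 2 ≤ L ^ 2 * s ^ 2 / 2 := by
      have : (lam : ℝ) ≤ L := by exact_mod_cast hL
      push_cast
      gcongr
    have h4 := h2.trans (Real.exp_le_exp.2 h3)
    rw [← ENNReal.ofReal_one]
    refine ENNReal.ofReal_le_ofReal ?_
    calc _ ≤ Real.exp (L ^ 2 * s ^ 2 / 2) * Real.exp (-(L ^ 2 * s ^ 2 / 2)) := by gcongr
      _ = 1 := by rw [← Real.exp_add]; simp
  · simp only [h1]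
    exact (h.integrable_exp_mul s).mul_const _
  · exact .of_forall fun x => (Real.exp_pos _).le

namespace IsUCBRun

/-- Maximal inequality for the centred sums while the number of pulls is at most `N`;
`s` fixes the side. -/
theorem measure_excess_ge_le [IsProbabilityMeasure P] (h : IsUCBRun P T ν ℱ A X)
    (a : Fin K) {lam L : ℝ≥0} (hsub : IsSubGaussian lam (ν a)) (hL : lam ≤ L) (s b N : ℝ) :
    P {ω | ∃ t ≤ T, (pulls A a t ω : ℝ) ≤ N ∧
      b ≤ s * excess A X (armMean ν a) a t ω} ≤
      ENNReal.ofReal (Real.exp (L ^ 2 * s ^ 2 / 2 * N - b)) := by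
  have hv := h.measure_exists_le_expMart a (hsub.lintegral_exp_le hL s)
    (ENNReal.ofReal (Real.exp (b - L ^ 2 * s ^ 2 / 2 * N)))
  have hpos : 0 < Real.exp (b - L ^ 2 * s ^ 2 / 2 * N) := Real.exp_pos _
  have e : Real.exp (L ^ 2 * s ^ 2 / 2 * N - b) = (Real.exp (b - L ^ 2 * s ^ 2 / 2 * N))⁻¹ := by
    rw [← Real.exp_neg]; congr 1; ring
  rw [e, ENNReal.ofReal_inv_of_pos hpos]
  refine le_trans (measure_mono ?_) (ENNReal.le_inv_iff_mul_le.2 (by rwa [mul_comm] at hv))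
  rintro ω ⟨t, ht, hN, hb⟩
  refine ⟨t, ht, ENNReal.ofReal_le_ofReal (Real.exp_le_exp.2 ?_)⟩
  have : L ^ 2 * s ^ 2 / 2 * (pulls A a t ω : ℝ) ≤ L ^ 2 * s ^ 2 / 2 * N := by gcongr
  change b ≤ s * excess A X (∫ y, y ∂ν a) a t ω at hb
  linarith

/-- The event that some sample mean deviates by more than a fraction `ε` of the bonus. -/
theorem measure_deviation_le [IsProbabilityMeasure P] (h : IsUCBRun P T ν ℱ A X)
    {lam : Fin K → ℝ≥0} {L : ℝ≥0} (hsub : ∀ a, IsSubGaussian (lam a) (ν a))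
    (hlam : ∀ a, lam a ≤ L) (hL : 0 < L) (hT : 2 ≤ T) {ε : ℝ} (hε : 0 < ε) :
    P {ω | ∃ a, ∃ t ≤ T, 0 < pulls A a t ω ∧
      ε * √(2 * Real.log T / pulls A a t ω) < |sampleMean A X a t ω - armMean ν a|} ≤
    ENNReal.ofReal (2 * K * (Nat.log 2 T + 1) *
      Real.exp (-(ε ^ 2 / (2 * (L : ℝ) ^ 2) * Real.log T))) := by
  have hL' : (0 : ℝ) < L := by exact_mod_cast hL
  have hlog : 0 < Real.log T := Real.log_pos (by exact_mod_cast hT)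
  set p := ENNReal.ofReal (Real.exp (-(ε ^ 2 / (2 * (L : ℝ) ^ 2) * Real.log T))) with hp
  -- the block in which the number of pulls is between `2 ^ j` and `2 ^ (j + 1)`
  let b : ℕ → ℝ := fun j => ε * √(2 * Real.log T * 2 ^ j)
  let s : ℕ → ℝ := fun j => b j / (2 * L ^ 2 * 2 ^ j)
  let E : ℝ → Fin K → ℕ → Set Ω := fun σ a j =>
    {ω | ∃ t ≤ T, (pulls A a t ω : ℝ) ≤ 2 ^ (j + 1) ∧
      s j * b j ≤ (σ * s j) * excess A X (armMean ν a) a t ω}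
  have hb : ∀ j, b j ^ 2 = ε ^ 2 * (2 * Real.log T * 2 ^ j) := fun j => by
    simp only [b]
    rw [mul_pow, Real.sq_sqrt (by positivity)]
  have hb0 : ∀ j, 0 < b j := fun j => by simp only [b]; positivity
  have hs0 : ∀ j, 0 < s j := fun j => div_pos (hb0 j) (by positivity)
  have hE : ∀ σ : ℝ, σ ^ 2 = 1 → ∀ a j, P (E σ a j) ≤ p := by
    intro σ hσ a j
    refine (h.measure_excess_ge_le a (hsub a) (hlam a) (σ * s j) (s j * b j) (2 ^ (j + 1))).trans ?_
    refine ENNReal.ofReal_le_ofReal (Real.exp_le_exp.2 (le_of_eq ?_))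
    rw [mul_pow, hσ, one_mul]
    have e1 : s j ^ 2 = b j ^ 2 / (2 * L ^ 2 * 2 ^ j) ^ 2 := by simp only [s]; rw [div_pow]
    have e2 : s j * b j = b j ^ 2 / (2 * L ^ 2 * 2 ^ j) := by simp only [s]; ring
    rw [e1, e2, hb, pow_succ]
    field_simp
    ring
  have hsubset : {ω | ∃ a, ∃ t ≤ T, 0 < pulls A a t ω ∧
      ε * √(2 * Real.log T / pulls A a t ω) < |sampleMean A X a t ω - armMean ν a|} ⊆
      ⋃ a : Fin K, ⋃ j ∈ Finset.range (Nat.log 2 T + 1), (E 1 a j ∪ E (-1) a j) := by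
    rintro ω ⟨a, t, ht, hpos, hdev⟩
    set n := pulls A a t ω with hn
    have hnT : n ≤ T := (pulls_le A a t ω).trans ht
    have hn0 : (0 : ℝ) < n := by exact_mod_cast hpos
    simp only [Set.mem_iUnion, Finset.mem_range]
    refine ⟨a, Nat.log 2 n, Nat.lt_succ_of_le (Nat.log_mono_right hnT), ?_⟩
    set j := Nat.log 2 n with hj
    have h1 : (2 : ℝ) ^ j ≤ n := by exact_mod_cast Nat.pow_log_le_self 2 hpos.ne'
    have h2 : (n : ℝ) ≤ 2 ^ (j + 1) := by
      exact_mod_cast (Nat.lt_pow_succ_log_self one_lt_two n).le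
    rw [sampleMean_sub A X _ a t ω hpos, abs_div, ← hn, abs_of_pos hn0, lt_div_iff₀ hn0] at hdev
    have h3 : b j ≤ |excess A X (armMean ν a) a t ω| := by
      refine le_trans ?_ hdev.le
      simp only [b]
      rw [mul_assoc ε]
      refine mul_le_mul_of_nonneg_left ?_ hε.le
      refine Real.sqrt_le_iff.2 ⟨by positivity, ?_⟩
      rw [mul_pow, Real.sq_sqrt (by positivity)]
      calc 2 * Real.log T * 2 ^ j ≤ 2 * Real.log T * n := by gcongr
        _ = _ := by field_simp
    rcases le_abs.1 h3 with h4 | h4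
    · left
      refine ⟨t, ht, h2, ?_⟩
      rw [one_mul]
      exact mul_le_mul_of_nonneg_left h4 (hs0 j).le
    · right
      refine ⟨t, ht, h2, ?_⟩
      have := mul_le_mul_of_nonneg_left h4 (hs0 j).le
      linarith
  calc _ ≤ ∑ a : Fin K, ∑ j ∈ Finset.range (Nat.log 2 T + 1), (p + p) := by
        refine (measure_mono hsubset).trans ((measure_iUnion_fintype_le _ _).trans ?_)
        refine Finset.sum_le_sum fun a _ => ?_
        refine (measure_biUnion_finset_le _ _).trans (Finset.sum_le_sum fun j _ => ?_)
        exact (measure_union_le _ _).trans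
          (add_le_add (hE 1 (by norm_num) a j) (hE (-1) (by norm_num) a j))
    _ = _ := by
        rw [ENNReal.ofReal_mul (by positivity), ← hp]
        simp only [Finset.sum_const, Finset.card_univ, Fintype.card_fin, Finset.card_range,
          nsmul_eq_mul, ← two_mul]
        rw [ENNReal.ofReal_mul (by positivity), ENNReal.ofReal_mul (by positivity)]
        have : ENNReal.ofReal ((Nat.log 2 T : ℝ) + 1) = ((Nat.log 2 T + 1 : ℕ) : ℝ≥0∞) := by
          rw [← ENNReal.ofReal_natCast]; push_cast; rfl
        rw [this]
        simp
        ring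

end IsUCBRun

/-- The bound in `IsUCBRun.measure_deviation_le` vanishes if `log K = o(log T)`. -/
theorem tendsto_deviation_bound {K : ℕ → ℕ} (hK : ∀ T, 0 < K T)
    (hgrowth : Tendsto (fun T : ℕ => Real.log (K T : ℝ) / Real.log (T : ℝ)) atTop (𝓝 0))
    {c : ℝ} (hc : 0 < c) :
    Tendsto (fun T : ℕ => ENNReal.ofReal (2 * K T * (Nat.log 2 T + 1) *
      Real.exp (-(c * Real.log T)))) atTop (𝓝 0) := by
  rw [← ENNReal.ofReal_zero]
  refine (ENNReal.continuous_ofReal.tendsto 0).comp ?_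
  have hlogT : Tendsto (fun T : ℕ => Real.log (T : ℝ)) atTop atTop :=
    Real.tendsto_log_atTop.comp tendsto_natCast_atTop_atTop
  have hlim : Tendsto (fun T : ℕ => 2 * (Real.log T / Real.log 2 + 1) *
      Real.exp (-(c / 2 * Real.log T))) atTop (𝓝 0) := by
    have h1 : Tendsto (fun x : ℝ => 2 * (x / Real.log 2 + 1) * Real.exp (-(c / 2 * x)))
        atTop (𝓝 0) := by
      have hx : Tendsto (fun x : ℝ => c / 2 * x) atTop atTop :=
        tendsto_id.const_mul_atTop (by positivity)
      have e1 := (Real.tendsto_pow_mul_exp_neg_atTop_nhds_zero 1).comp hx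
      have e0 := (Real.tendsto_pow_mul_exp_neg_atTop_nhds_zero 0).comp hx
      have := (e1.const_mul (4 / (c * Real.log 2))).add (e0.const_mul 2)
      simp only [mul_zero, add_zero] at this
      refine this.congr fun x => ?_
      simp only [Function.comp_apply, pow_one, pow_zero, one_mul]
      field_simp
      ring
    exact h1.comp hlogT
  refine squeeze_zero' (.of_forall fun T => by positivity) ?_ hlim
  -- Eventually K ≤ T^(c/2): one half of the factor T^(-c) absorbs K, the other half beats the
  -- logarithm.
  filter_upwards [hgrowth.eventually_lt_const (show 0 < c / 2 by positivity),
    hlogT.eventually_gt_atTop 0, eventually_ge_atTop 1] with T hT hlog hT1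
  have hKpos : (0 : ℝ) < K T := by exact_mod_cast hK T
  rw [div_lt_iff₀ hlog] at hT
  have h1 : (K T : ℝ) ≤ Real.exp (c / 2 * Real.log T) := by
    rw [← Real.log_le_iff_le_exp hKpos]; exact hT.le
  have h2 : (Nat.log 2 T : ℝ) ≤ Real.log T / Real.log 2 := by
    have := Real.natLog_le_logb T 2
    rwa [Real.logb] at this
  have h3 : Real.exp (-(c * Real.log T)) =
      Real.exp (-(c / 2 * Real.log T)) * Real.exp (-(c / 2 * Real.log T)) := by
    rw [← Real.exp_add]; congr 1; ring
  have h4 : (K T : ℝ) * Real.exp (-(c / 2 * Real.log T)) ≤ 1 := by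
    rw [Real.exp_neg, ← div_eq_mul_inv, div_le_one (Real.exp_pos _)]
    exact h1
  rw [h3]
  calc _ = 2 * (Nat.log 2 T + 1) * Real.exp (-(c / 2 * Real.log T)) *
        (K T * Real.exp (-(c / 2 * Real.log T))) := by ring
    _ ≤ 2 * (Nat.log 2 T + 1) * Real.exp (-(c / 2 * Real.log T)) * 1 := by gcongr
    _ ≤ _ := by rw [mul_one]; gcongr

end UCB

/-! ### The predicted counts, the balance of UCB, and the good event -/

namespace UCB

/-- The sum is strictly increasing and continuous in n > 0. At n = T/card each term is at most
1/card; at n = T the term with `c i = 0` alone equals 1. The intermediate value theorem applies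
between these points. -/
theorem existsUnique_sum_inv_sq_eq_one {ι : Type*} [Fintype ι] {c : ι → ℝ} (hc : ∀ a, 0 ≤ c a)
    {i : ι} (hi : c i = 0) {T : ℝ} (hT : 0 < T) :
    ∃! n : ℝ, 0 < n ∧ ∑ a, 1 / (√(T / n) + c a) ^ 2 = 1 := by
  have : Nonempty ι := ⟨i⟩
  set F : ℝ → ℝ := fun n => ∑ a, 1 / (√(T / n) + c a) ^ 2 with hF
  have hpos : ∀ n, 0 < n → ∀ a, 0 < √(T / n) + c a := fun n hn a =>
    add_pos_of_pos_of_nonneg (Real.sqrt_pos.2 (by positivity)) (hc a)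
  have hmono : StrictMonoOn F (Set.Ioi 0) := by
    intro x (hx : 0 < x) y (hy : 0 < y) hxy
    refine Finset.sum_lt_sum_of_nonempty Finset.univ_nonempty fun a _ => ?_
    have h1 := hpos y hy a
    have h2 : √(T / y) < √(T / x) := Real.sqrt_lt_sqrt (by positivity) (by gcongr)
    gcongr
  have hcard : (1 : ℝ) ≤ Fintype.card ι := by exact_mod_cast Fintype.card_pos
  have hcont : ContinuousOn F (Set.Icc (T / Fintype.card ι) T) := by
    refine continuousOn_finsetSum _ fun a _ => ?_
    have hne : ∀ n ∈ Set.Icc (T / Fintype.card ι) T, 0 < n := fun n hn =>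
      lt_of_lt_of_le (by positivity) hn.1
    refine ContinuousOn.div continuousOn_const ?_ fun n hn => (pow_pos (hpos n (hne n hn) a) 2).ne'
    refine ContinuousOn.pow (ContinuousOn.add (ContinuousOn.sqrt ?_) continuousOn_const) 2
    exact ContinuousOn.div continuousOn_const continuousOn_id fun n hn => (hne n hn).ne'
  have hlow : F (T / Fintype.card ι) ≤ 1 := by
    have : F (T / Fintype.card ι) ≤ ∑ _a : ι, 1 / (Fintype.card ι : ℝ) := by
      refine Finset.sum_le_sum fun a _ => ?_
      gcongr
      have e : T / (T / Fintype.card ι) = Fintype.card ι := by field_simp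
      rw [e]
      calc (Fintype.card ι : ℝ) = √(Fintype.card ι) ^ 2 := (Real.sq_sqrt (by positivity)).symm
        _ ≤ _ := by gcongr; linarith [hc a]
    refine this.trans (le_of_eq ?_)
    simp
  have hhigh : 1 ≤ F T := by
    have h1 : 1 / (√(T / T) + c i) ^ 2 ≤ F T :=
      Finset.single_le_sum (f := fun a => 1 / (√(T / T) + c a) ^ 2)
        (fun a _ => by positivity) (Finset.mem_univ i)
    rw [hi, div_self hT.ne'] at h1
    simpa using h1
  have hle : T / Fintype.card ι ≤ T := div_le_self hT.le hcard
  obtain ⟨n, hn, hn1⟩ := intermediate_value_Icc hle hcont ⟨hlow, hhigh⟩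
  have hn0 : 0 < n := lt_of_lt_of_le (by positivity) hn.1
  exact ⟨n, ⟨hn0, hn1⟩, fun y ⟨hy, hy1⟩ => hmono.injOn hy hn0 (hy1.trans hn1.symm)⟩

section Gap

variable {K : ℕ} (ν : Fin K → Measure ℝ)

theorem gap_nonneg (a : Fin K) : 0 ≤ gap ν a :=
  sub_nonneg.2 (le_ciSup (Set.finite_range (armMean ν)).bddAbove a)

theorem exists_gap_eq_zero (hK : 0 < K) : ∃ i, gap ν i = 0 := by
  have : Nonempty (Fin K) := ⟨⟨0, hK⟩⟩
  obtain ⟨i, hi⟩ := exists_eq_ciSup_of_finite (f := armMean ν)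
  exact ⟨i, by rw [gap, ← hi, sub_self]⟩

end Gap

theorem sqrt_mul_sq_div {x g l : ℝ} (hx : 0 ≤ x) (hg : 0 ≤ g) :
    √(x * g ^ 2 / l) = √x * (g / √l) := by
  rw [mul_div_assoc, Real.sqrt_mul hx, Real.sqrt_div (sq_nonneg g), Real.sqrt_sq hg]

/-- Dividing out T turns the equation for n⋆ into a statement about predicted counts, directly
comparable with `sum_pulls`. -/
theorem IsNStar.sum_eq {K T : ℕ} (hT : 0 < T) {Δ : Fin K → ℝ} (hΔ : ∀ a, 0 ≤ Δ a) {n : ℝ}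
    (h : IsNStar T Δ n) :
    ∑ a, ((1 / √n + Δ a / √(2 * Real.log T)) ^ 2)⁻¹ = (T : ℝ) := by
  have hT' : (0 : ℝ) < T := by exact_mod_cast hT
  have e : ∀ a, 1 / (√((T : ℝ) / n) + √((T : ℝ) * Δ a ^ 2 / (2 * Real.log (T : ℝ)))) ^ 2 =
      (T : ℝ)⁻¹ * ((1 / √n + Δ a / √(2 * Real.log T)) ^ 2)⁻¹ := fun a => by
    rw [sqrt_mul_sq_div hT'.le (hΔ a), Real.sqrt_div hT'.le, div_eq_mul_one_div (√(T : ℝ)) (√n),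
      ← mul_add, mul_pow, Real.sq_sqrt hT'.le, one_div, mul_inv]
  have h2 := h.2
  simp only [e] at h2
  rw [← Finset.mul_sum, inv_mul_eq_iff_eq_mul₀ hT'.ne', mul_one] at h2
  exact h2

theorem pullRatio_eq {Ω : Type*} {K : ℕ} (T : ℕ) (Δ : Fin K → ℝ) (n : ℝ)
    (A : ℕ → Ω → Fin K) (a : Fin K) (ω : Ω) :
    pullRatio T Δ n A a ω =
      (pulls A a T ω : ℝ) / ((1 / √n + Δ a / √(2 * Real.log T)) ^ 2)⁻¹ := by
  rw [pullRatio, zpow_neg]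
  norm_cast

theorem ncard_nearOptimal {K : ℕ} (T : ℕ) {Δ : Fin K → ℝ} (hΔ : ∀ a, 0 ≤ Δ a) {n : ℝ}
    (hn : 0 < n) (B : ℝ) :
    (nearOptimal T Δ n B).ncard = (Finset.univ.filter
      (fun a => Δ a / √(2 * Real.log T) ≤ B * (1 / √n))).card := by
  rw [← Set.ncard_coe_finset]
  congr 1
  ext a
  have : 0 < √n := Real.sqrt_pos.2 hn
  simp only [nearOptimal, Set.mem_ofPred_eq, Finset.coe_filter, Finset.mem_univ, true_and]
  rw [sqrt_mul_sq_div hn.le (hΔ a), mul_one_div, le_div_iff₀ this, mul_comm]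

/-- If all sample means are accurate up to a fraction `ε` of the bonus, the pull counts are
approximately balanced. -/
theorem balance_of_accurate {Ω : Type*} {K T : ℕ} (hT : 2 ≤ T) (ν : Fin K → Measure ℝ)
    (A : ℕ → Ω → Fin K) (X : ℕ → Ω → ℝ) {ε : ℝ} (hε1 : ε < 1) {ω : Ω}
    (hinit : ∀ a : Fin K, pulls A a K ω = 1)
    (hargmax : ∀ t, K ≤ t → t < T → ∀ a : Fin K, ucb T A X a t ω ≤ ucb T A X (A (t + 1) ω) t ω)
    (hacc : ∀ a, ∀ t ≤ T, 0 < pulls A a t ω →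
      |sampleMean A X a t ω - armMean ν a| ≤ ε * √(2 * Real.log T / pulls A a t ω))
    (hKT : K ≤ T) (b : Fin K) (hb : 2 ≤ pulls A b T ω) (a : Fin K) :
    (1 - ε) / √(pulls A a T ω) - gap ν a / √(2 * Real.log T) ≤
      (1 + ε) / √((pulls A b T ω : ℝ) - 1) - gap ν b / √(2 * Real.log T) := by
  -- Just before its last pull arm `b` had n_b - 1 pulls. That pull comes after initialization, so
  -- the maximality of its index applies.
  obtain ⟨u, hKu, huT, hA, hu⟩ :=
    exists_last_pull A b (s := K) ω T hKT (by rw [hinit]; omega)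
  have hlog : 0 < 2 * Real.log T := by
    have := Real.log_pos (show (1 : ℝ) < T by exact_mod_cast hT)
    positivity
  set l := √(2 * Real.log T) with hl
  have hl0 : 0 < l := Real.sqrt_pos.2 hlog
  have hpos : ∀ c, 0 < pulls A c u ω := fun c => by
    have : pulls A c K ω ≤ pulls A c u ω := pulls_mono A c ω hKu
    rw [hinit] at this
    omega
  have h1 := hargmax u hKu huT a
  have ha := abs_le.1 (hacc a u huT.le (hpos a))
  have hb' := abs_le.1 (hacc b u huT.le (hpos b))
  have hbu : (pulls A b T ω : ℝ) - 1 = pulls A b u ω := by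
    rw [← hu]; push_cast; ring
  rw [hA, ucb, ucb] at h1
  rw [hbu]
  rw [Real.sqrt_div hlog.le, ← hl] at h1 ha hb'
  rw [Real.sqrt_div hlog.le, ← hl] at h1
  have h2 : (1 - ε) * (l / √(pulls A a u ω)) + armMean ν a ≤
      (1 + ε) * (l / √(pulls A b u ω)) + armMean ν b := by linarith [ha.1, hb'.2]
  -- The count of `a` can only grow from round `u` to T, so its bonus at T is no larger.
  have h3 : (1 - ε) * (l / √(pulls A a T ω)) ≤ (1 - ε) * (l / √(pulls A a u ω)) := by
    have h4 : (0 : ℝ) < pulls A a u ω := by exact_mod_cast hpos a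
    have h5 : (pulls A a u ω : ℝ) ≤ pulls A a T ω := by
      exact_mod_cast pulls_mono A a ω huT.le
    have h6 : 0 ≤ 1 - ε := by linarith
    have h7 : 0 < √(pulls A a u ω : ℝ) := Real.sqrt_pos.2 h4
    gcongr
  have h8 : (1 - ε) * (l / √(pulls A a T ω)) - gap ν a ≤
      (1 + ε) * (l / √(pulls A b u ω)) - gap ν b := by
    simp only [gap]
    linarith
  have h9 := div_le_div_of_nonneg_right h8 hl0.le
  rw [sub_div, sub_div] at h9
  have e : ∀ x y : ℝ, x * (l / y) / l = x / y := fun x y => by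
    field_simp
  rwa [e, e] at h9

/-- Eventually K ≤ √T, so K/T ≤ T^(-1/2). This makes the additive 1 per arm negligible in total and
ensures K ≤ T, as `hrun` requires. -/
theorem tendsto_arms_div_horizon {K : ℕ → ℕ} (hK : ∀ T, 0 < K T)
    (hgrowth : Tendsto (fun T : ℕ => Real.log (K T : ℝ) / Real.log (T : ℝ)) atTop (𝓝 0)) :
    Tendsto (fun T : ℕ => (K T : ℝ) / T) atTop (𝓝 0) := by
  have hlogT : Tendsto (fun T : ℕ => Real.log (T : ℝ)) atTop atTop :=
    Real.tendsto_log_atTop.comp tendsto_natCast_atTop_atTop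
  have hlim : Tendsto (fun T : ℕ => Real.exp (-(1 / 2 * Real.log (T : ℝ)))) atTop (𝓝 0) :=
    Real.tendsto_exp_neg_atTop_nhds_zero.comp (hlogT.const_mul_atTop (by norm_num))
  refine squeeze_zero' (.of_forall fun T => by positivity) ?_ hlim
  filter_upwards [hgrowth.eventually_lt_const (show (0 : ℝ) < 1 / 2 by norm_num),
    hlogT.eventually_gt_atTop 0, eventually_ge_atTop 1] with T hT hlog hT1
  have hKpos : (0 : ℝ) < K T := by exact_mod_cast hK T
  have hTpos : (0 : ℝ) < T := by exact_mod_cast hT1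
  rw [div_lt_iff₀ hlog] at hT
  rw [← Real.log_le_iff_le_exp (by positivity), Real.log_div hKpos.ne' hTpos.ne']
  linarith

/-- Each of the K predicted counts is at most n⋆ and they sum to T, hence n⋆ ≥ T/K. -/
theorem IsNStar.inv_sqrt_sq_le {K T : ℕ} (hT : 0 < T) {Δ : Fin K → ℝ} (hΔ : ∀ a, 0 ≤ Δ a) {n : ℝ}
    (h : IsNStar T Δ n) : (1 / √n) ^ 2 ≤ K / T := by
  have hT' : (0 : ℝ) < T := by exact_mod_cast hT
  have hn : 0 < √n := Real.sqrt_pos.2 h.1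
  have h1 : (T : ℝ) ≤ K * (((1 / √n) ^ 2)⁻¹) := by
    rw [← h.sum_eq hT hΔ]
    have := Finset.sum_le_card_nsmul (Finset.univ : Finset (Fin K))
      (fun a => ((1 / √n + Δ a / √(2 * Real.log T)) ^ 2)⁻¹) (((1 / √n) ^ 2)⁻¹) (fun a _ => by
        have : 0 ≤ Δ a / √(2 * Real.log T) := div_nonneg (hΔ a) (Real.sqrt_nonneg _)
        gcongr
        linarith)
    simpa using this
  rw [← div_eq_mul_inv, le_div_iff₀ (by positivity)] at h1
  rw [le_div_iff₀ hT']
  linarith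

/-- Outside events of vanishing probability all pull ratios are close to `1`, up to the inverse of
the predicted number of pulls. -/
theorem exists_bad_event
    {Ω : ℕ → Type*} [m : ∀ T, MeasurableSpace (Ω T)]
    (P : ∀ T, Measure (Ω T)) [∀ T, IsProbabilityMeasure (P T)]
    (K : ℕ → ℕ) (hK : ∀ T, 0 < K T)
    (ν : ∀ T, Fin (K T) → Measure ℝ)
    (ℱ : ∀ T, Filtration ℕ (m T))
    (A : ∀ T, ℕ → Ω T → Fin (K T)) (X : ∀ T, ℕ → Ω T → ℝ)
    (hrun : ∀ T, K T ≤ T → IsUCBRun (P T) T (ν T) (ℱ T) (A T) (X T))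
    (lam : ∀ T, Fin (K T) → ℝ≥0) (L : ℝ≥0) (hlam : ∀ T a, lam T a ≤ L)
    (hsub : ∀ T a, IsSubGaussian (lam T a) (ν T a))
    (hgrowth : Tendsto (fun T : ℕ => Real.log (K T : ℝ) / Real.log (T : ℝ)) atTop (𝓝 0))
    (nstar : ℕ → ℝ) (hn : ∀ T : ℕ, 2 ≤ T → IsNStar T (gap (ν T)) (nstar T))
    {B α : ℝ} (hB : 0 < B) (hα : 0 < α) {T₀ : ℕ} (hnear : ∀ T : ℕ, T₀ ≤ T →
      α ≤ ((nearOptimal T (gap (ν T)) (nstar T) B).ncard : ℝ) / (K T : ℝ))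
    {τ : ℝ} (hτ : 0 < τ) :
    ∃ E : ∀ T, Set (Ω T), Tendsto (fun T => P T (E T)) atTop (𝓝 0) ∧
      ∀ᶠ T in atTop, ∀ ω, ω ∉ E T → ∀ a,
        |pullRatio T (gap (ν T)) (nstar T) (A T) a ω - 1| ≤
          τ + (1 / √(nstar T) + gap (ν T) a / √(2 * Real.log (T : ℝ))) ^ 2 := by
  obtain ⟨ε, κ, hε, hε1, hκ, key⟩ := exists_tolerance hB hα hτ
  -- L = 0 is allowed, while the deviation bound divides by L²; hence L + 1.
  have hL : 0 < L + 1 := by positivity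
  have hKT := tendsto_arms_div_horizon hK hgrowth
  let D : ∀ T, Set (Ω T) := fun T => {ω | ∃ a, ∃ t ≤ T, 0 < pulls (A T) a t ω ∧
      ε * √(2 * Real.log T / pulls (A T) a t ω) <
        |sampleMean (A T) (X T) a t ω - armMean (ν T) a|}
  let N : ∀ T, Set (Ω T) := fun T => {ω | ¬ ((∀ a, pulls (A T) a (K T) ω = 1) ∧
    ∀ t, K T ≤ t → t < T → ∀ a,
      ucb T (A T) (X T) a t ω ≤ ucb T (A T) (X T) (A T (t + 1) ω) t ω)}
  have hKle : ∀ᶠ T : ℕ in atTop, K T ≤ T := by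
    filter_upwards [hKT.eventually_lt_const one_pos, eventually_ge_atTop 1] with T hT hT1
    rw [div_lt_one (by exact_mod_cast hT1)] at hT
    exact_mod_cast hT.le
  refine ⟨fun T => D T ∪ N T, ?_, ?_⟩
  · refine tendsto_of_tendsto_of_tendsto_of_le_of_le' tendsto_const_nhds
      (tendsto_deviation_bound hK hgrowth
        (show 0 < ε ^ 2 / (2 * ((L + 1 : ℝ≥0) : ℝ) ^ 2) by positivity)) (.of_forall fun _ => zero_le) ?_
    filter_upwards [hKle, eventually_ge_atTop 2] with T hKT hT
    have hN : P T (N T) = 0 := ae_iff.1 ((hrun T hKT).init.and (hrun T hKT).argmax)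
    refine (measure_union_le _ _).trans ?_
    rw [hN, add_zero]
    exact (hrun T hKT).measure_deviation_le (hsub T)
      (fun a => (hlam T a).trans (by simp)) hL hT hε
  · filter_upwards [hKle, eventually_ge_atTop 2, eventually_ge_atTop T₀,
      hKT.eventually_lt_const hκ] with T hKT hT hT0 hκT ω hω a
    have hTpos : (0 : ℝ) < T := by positivity
    have hKpos : (0 : ℝ) < K T := by exact_mod_cast hK T
    simp only [Set.mem_union, not_or] at hω
    obtain ⟨hω1, hω2⟩ := hω
    obtain ⟨hinit, hargmax⟩ := not_not.1 hω2
    have hacc : ∀ a, ∀ t ≤ T, 0 < pulls (A T) a t ω →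
        |sampleMean (A T) (X T) a t ω - armMean (ν T) a| ≤
          ε * √(2 * Real.log T / pulls (A T) a t ω) := by
      intro a t ht hp
      by_contra! h
      exact hω1 ⟨a, t, ht, hp, h⟩
    obtain ⟨i, hi⟩ := exists_gap_eq_zero (ν T) (hK T)
    have hnT := hn T hT
    have hr : 0 < 1 / √(nstar T) := one_div_pos.2 (Real.sqrt_pos.2 hnT.1)
    have hone : ∀ a, 1 ≤ pulls (A T) a T ω := fun a => by
      rw [← hinit a]; exact pulls_mono (A T) a ω hKT
    rw [pullRatio_eq]
    refine key (δ := fun a => gap (ν T) a / √(2 * Real.log T))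
      (n := fun a => (pulls (A T) a T ω : ℝ)) (T := T)
      (fun a => div_nonneg (gap_nonneg (ν T) a) (Real.sqrt_nonneg _)) (fun a => ?_)
      (i := i) (by simp [hi]) hr hTpos ?_ (hnT.sum_eq (by omega) (gap_nonneg (ν T))) ?_
      (fun b hb a => balance_of_accurate hT (ν T) (A T) (X T) hε1 hinit hargmax hacc hKT b
        (by exact_mod_cast hb) a) ?_ a
    · rcases (hone a).eq_or_lt with h | h
      · left; exact_mod_cast h.symm
      · right; exact_mod_cast h
    · rw [← ncard_nearOptimal T (gap_nonneg (ν T)) hnT.1, Fintype.card_fin, ← le_div_iff₀ hKpos]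
      exact hnear T hT0
    · rw [← Nat.cast_sum, sum_pulls]
    · rw [Fintype.card_fin, ← div_le_iff₀ hTpos]
      exact hκT.le

end UCB
-- Convergence in probability
theorem theorem3
    -- for each horizon `T`: a probability space, the arms and their reward distributions
    {Ω : ℕ → Type*} [m : ∀ T, MeasurableSpace (Ω T)]
    (P : ∀ T, Measure (Ω T)) [∀ T, IsProbabilityMeasure (P T)]
    (K : ℕ → ℕ) (hK : ∀ T, 0 < K T)
    (ν : ∀ T, Fin (K T) → Measure ℝ) [∀ T a, IsProbabilityMeasure (ν T a)]
    -- a run of the UCB algorithm for each horizon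
    (ℱ : ∀ T, Filtration ℕ (m T))
    (A : ∀ T, ℕ → Ω T → Fin (K T)) (X : ∀ T, ℕ → Ω T → ℝ)
    (hrun : ∀ T, K T ≤ T → UCB.IsUCBRun (P T) T (ν T) (ℱ T) (A T) (X T))
    -- sub-Gaussian rewards with bounded parameters
    (lam : ∀ T, Fin (K T) → ℝ≥0) (L : ℝ≥0) (hlam : ∀ T a, lam T a ≤ L)
    (hsub : ∀ T a, UCB.IsSubGaussian (lam T a) (ν T a))
    -- growth of the number of arms
    (hgrowth : Tendsto (fun T : ℕ => Real.log (K T : ℝ) / Real.log (T : ℝ)) atTop (𝓝 0)) :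
    -- `n⋆` is well defined
    (∀ T : ℕ, 2 ≤ T → ∃! n : ℝ, UCB.IsNStar T (UCB.gap (ν T)) n) ∧
    ∀ nstar : ℕ → ℝ, (∀ T : ℕ, 2 ≤ T → UCB.IsNStar T (UCB.gap (ν T)) (nstar T)) →
      -- a fixed fraction of the arms is near-optimal
      (∃ B : ℝ, 0 < B ∧ ∃ α : ℝ, 0 < α ∧ ∃ T₀ : ℕ, ∀ T : ℕ, T₀ ≤ T →
        α ≤ ((UCB.nearOptimal T (UCB.gap (ν T)) (nstar T) B).ncard : ℝ) / (K T : ℝ)) →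
      -- every arm, possibly changing with `T`, whose gap is `o(√(2 log T))`, is stable
      (∀ a : ∀ T, Fin (K T),
        Tendsto (fun T : ℕ => UCB.gap (ν T) (a T) / √(2 * Real.log (T : ℝ))) atTop (𝓝 0) →
        UCB.TendstoInProb P
          (fun T => UCB.pullRatio T (UCB.gap (ν T)) (nstar T) (A T) (a T)) 1) ∧
      -- if all gaps are `o(√(2 log T))` uniformly, then all arms are stable uniformly
      (Tendsto (fun T : ℕ => ⨆ a : Fin (K T), UCB.gap (ν T) a / √(2 * Real.log (T : ℝ)))
          atTop (𝓝 0) →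
        UCB.TendstoInProb P
          (fun T ω => ⨆ a : Fin (K T),
            |UCB.pullRatio T (UCB.gap (ν T)) (nstar T) (A T) a ω - 1|) 0) := by
  constructor
  · intro T hT
    obtain ⟨i, hi⟩ := UCB.exists_gap_eq_zero (ν T) (hK T)
    exact UCB.existsUnique_sum_inv_sq_eq_one (fun a => Real.sqrt_nonneg _) (i := i) (by simp [hi])
      (show (0 : ℝ) < T by positivity)
  rintro nstar hn ⟨B, hB, α, hα, T₀, hnear⟩
  have hr : Tendsto (fun T => 1 / √(nstar T)) atTop (𝓝 0) := by
    have h1 : Tendsto (fun T => (1 / √(nstar T)) ^ 2) atTop (𝓝 0) := by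
      refine squeeze_zero' (.of_forall fun T => by positivity) ?_
        (UCB.tendsto_arms_div_horizon hK hgrowth)
      filter_upwards [eventually_ge_atTop 2] with T hT
      exact (hn T hT).inv_sqrt_sq_le (by omega) (UCB.gap_nonneg (ν T))
    have h2 := h1.sqrt
    rw [Real.sqrt_zero] at h2
    exact h2.congr fun T => Real.sqrt_sq (by positivity)
  -- Here `d` is the scaled gap of the chosen arm in the first claim and the largest scaled gap in
  -- the second.
  have hsmall : ∀ d : ℕ → ℝ, Tendsto d atTop (𝓝 0) → ∀ ε : ℝ, 0 < ε →
      ∀ᶠ T in atTop, ε / 2 + (1 / √(nstar T) + d T) ^ 2 < ε := by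
    intro d hd ε hε
    have h1 := ((hr.add hd).pow 2).const_add (ε / 2)
    refine h1.eventually_lt_const ?_
    norm_num
    exact hε
  have hfinish : ∀ (Y : ∀ T, Ω T → ℝ) (c ε : ℝ) (E : ∀ T, Set (Ω T)),
      Tendsto (fun T => P T (E T)) atTop (𝓝 0) →
      (∀ᶠ T in atTop, ∀ ω, ω ∉ E T → |Y T ω - c| < ε) →
      Tendsto (fun T => P T {ω | ε ≤ |Y T ω - c|}) atTop (𝓝 0) := by
    intro Y c ε E hE hY
    refine tendsto_of_tendsto_of_tendsto_of_le_of_le' tendsto_const_nhds hE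
      (.of_forall fun _ => zero_le) ?_
    filter_upwards [hY] with T hT
    refine measure_mono fun ω hω => ?_
    by_contra h
    exact absurd (hT ω h) (not_lt.2 hω)
  constructor
  · intro a ha ε hε
    obtain ⟨E, hE, hbound⟩ := UCB.exists_bad_event P K hK ν ℱ A X hrun lam L hlam hsub hgrowth
      nstar hn hB hα hnear (half_pos hε)
    refine hfinish _ 1 ε E hE ?_
    filter_upwards [hbound, hsmall _ ha ε hε] with T h1 h2 ω hω
    exact (h1 ω hω (a T)).trans_lt h2
  · intro hmax ε hε
    obtain ⟨E, hE, hbound⟩ := UCB.exists_bad_event P K hK ν ℱ A X hrun lam L hlam hsub hgrowth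
      nstar hn hB hα hnear (half_pos hε)
    refine hfinish _ 0 ε E hE ?_
    filter_upwards [hbound, hsmall _ hmax ε hε] with T h1 h2 ω hω
    have : Nonempty (Fin (K T)) := ⟨⟨0, hK T⟩⟩
    rw [sub_zero, abs_of_nonneg (Real.iSup_nonneg fun a => abs_nonneg _)]
    refine (ciSup_le fun a => (h1 ω hω a).trans ?_).trans_lt h2
    have h3 : UCB.gap (ν T) a / √(2 * Real.log (T : ℝ)) ≤
        ⨆ a : Fin (K T), UCB.gap (ν T) a / √(2 * Real.log (T : ℝ)) :=
      le_ciSup (f := fun a => UCB.gap (ν T) a / √(2 * Real.log (T : ℝ)))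
        (Set.finite_range _).bddAbove a
    have h4 : 0 ≤ UCB.gap (ν T) a / √(2 * Real.log (T : ℝ)) :=
      div_nonneg (UCB.gap_nonneg (ν T) a) (Real.sqrt_nonneg _)
    gcongr
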